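/- Let $G$ be a discrete group with identity $e$. For $M, T\subseteq G$, say that $T$ is $M$-large if $m(G\setminus T)\subseteq T$ for all $m\in M$. For $H, F\subseteq G$, say that $H$ is a Powers set for $F$ if for every $N\in\mathbb N$ there are $h_1,\dots,h_N\in H$ and pairwise disjoint subsets $T_1,\dots,T_N$ of $G$ such that $T_j$ is $h_jFh_j^{-1}$-large for $j=1,\dots,N$. For $g\in G\setminus\{e\}$, say that $H$ is a c-Powers set for $g$ if $H$ is a Powers set for $\{aga^{-1} : a\in M\}$ for every finite non-empty $M\subseteq H$. The group $G$ is a *PH group* if every finite non-empty $F\subseteq G\setminus\{e\}$ can be written as $F=\{f_1,\dots,f_n\}$ with distinct $f_j$ such that there is a chain of subgroups $G_1\subseteq G_2\subseteq\cdots\subseteq G_n$ of $G$ with $G_j$ a c-Powers set for $f_j$, $j=1,\dots,n$. The group $G$ has *property* $(P_{\rm com})$ if for every finite non-empty $F\subseteq G\setminus\{e\}$ there are $n\in\mathbb N$, $g_0\in G$ and subsets $U,D_1,\dots,D_n$ of $G$ such that (i) $G\setminus U\subseteq D_1\cup\dots\cup D_n$; (ii) $gU\cap U=\emptyset$ for all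 $g\in F$; (iii) $g_0^{-j}D_k\cap D_k=\emptyset$ for all integers $j\ge 1$ and all $k=1,\dots,n$. Let $\mathcal P$ be the class of all groups that are PH groups or have property $(P_{\rm com})$. Let $\omega: G\times G\to\mathbb T$ be a $2$-cocycle, that is, $\omega(g,h)\,\omega(gh,k)=\omega(h,k)\,\omega(g,hk)$ for all $g,h,k\in G$ (the normalization $\omega(g,e)=\omega(e,g)=1$ is allowed but not required). Let $C_r^*(G,\omega)$ be the C$^*$-subalgebra of $\mathcal B(\ell^2(G))$ generated by the unitaries $\lambda(g)$, $g\in G$, given by $(\lambda(g)\xi)(h)=\omega(h^{-1},g)\,\xi(g^{-1}h)$ for $\xi\in\ell^2(G)$ and $h\in G$. **Corollary.** If $G\in\mathcal P$ and $\omega$ is a $2$-cocycle on $G$ with values in $\mathbb T$, then $C_r^*(G,\omega)$ is simple (it is nonzero, and its only closed two-sided ideals are $\{0\}$ and itself) and it has a unique tracial state (a unique positive linear functional $\tau$ with $\tau(1)=1$ and $\tau(xy)=\tau(yx)$ for all $x,y$). -/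

import Mathlib

open scoped Pointwise ComplexOrder ENNReal

/-! ### PH groups and groups with property (P_com) -/

section Groups

variable {G : Type*} [Group G]

/-- `T ⊆ G` is `M`-large in `G`: `m (G ∖ T) ⊆ T` for all `m ∈ M`. -/
def IsLargeFor (M T : Set G) : Prop :=
  ∀ m ∈ M, m • Tᶜ ⊆ T

/-- `H ⊆ G` is a Powers set for `F`: for every `N` there are `h₁, …, h_N ∈ H` and pairwise
disjoint subsets `T₁, …, T_N` of `G` such that `T_j` is `h_j F h_j⁻¹`-large. -/
def IsPowersSet (H F : Set G) : Prop :=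
  ∀ N : ℕ, ∃ (h : Fin N → G) (T : Fin N → Set G),
    (∀ j, h j ∈ H) ∧
    (∀ i j, i ≠ j → Disjoint (T i) (T j)) ∧
    ∀ j, IsLargeFor ((fun x => h j * x * (h j)⁻¹) '' F) (T j)

/-- `⟨g⟩_M = {a g a⁻¹ | a ∈ M}`. -/
def conjugatesBy (g : G) (M : Set G) : Set G :=
  (fun a => a * g * a⁻¹) '' M

/-- `H ⊆ G` is a c-Powers set for `g`: it is a Powers set for `⟨g⟩_M` for all finite non-empty
subsets `M` of `H`. -/
def IsCPowersSet (H : Set G) (g : G) : Prop :=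
  ∀ M : Set G, M.Finite → M.Nonempty → M ⊆ H → IsPowersSet H (conjugatesBy g M)

variable (G)

/-- `G` is a PH group: every finite non-empty `F ⊆ G ∖ {e}` can be enumerated as
`F = {f₁, …, f_n}` so that there is a chain of subgroups `G₁ ⊆ ⋯ ⊆ G_n` of `G` with `G_j` a
c-Powers set for `f_j` for every `j`. -/
def IsPHGroup : Prop :=
  ∀ F : Set G, F.Finite → F.Nonempty → (1 : G) ∉ F →
    ∃ (n : ℕ) (f : Fin n → G) (K : Fin n → Subgroup G),
      Function.Injective f ∧ Set.range f = F ∧ Monotone K ∧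
      ∀ j, IsCPowersSet (K j : Set G) (f j)

/-- Property (P_com). The exponent `j` in the last clause runs over the positive integers. -/
def HasPropertyPcom : Prop :=
  ∀ F : Set G, F.Finite → F.Nonempty → (1 : G) ∉ F →
    ∃ (n : ℕ) (g₀ : G) (U : Set G) (D : Fin n → Set G),
      Uᶜ ⊆ ⋃ k, D k ∧
      (∀ g ∈ F, (g • U) ∩ U = ∅) ∧
      ∀ (j : ℕ) (k : Fin n), 1 ≤ j → ((g₀ ^ j)⁻¹ • D k) ∩ D k = ∅

/-- The class `𝒫` of (discrete) groups: PH groups together with groups having property (P_com). -/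
def InClassP : Prop :=
  IsPHGroup G ∨ HasPropertyPcom G

end Groups

/-! ### The twisted reduced group C*-algebra -/

section Twisted

variable {G : Type*} [Group G]

/-- 2-cocycles on `G` with values in the circle (with trivial action of `G`). The condition
`ω(g, e) = ω(e, g) = 1`, often included, is not imposed. -/
def IsCircleTwoCocycle (ω : G → G → Circle) : Prop :=
  ∀ g h k : G, ω g h * ω (g * h) k = ω h k * ω g (h * k)

/-- The Hilbert space `ℓ²(G)`. -/
abbrev ellTwo (G : Type*) : Type _ := lp (fun _ : G => ℂ) 2

theorem norm_twistedTranslate (ω : G → G → Circle) (g : G) (ξ : G → ℂ) (h : G) :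
    ‖(ω h⁻¹ g : ℂ) * ξ (g⁻¹ * h)‖ = ‖ξ (g⁻¹ * h)‖ := by
  rw [norm_mul, Circle.norm_coe, one_mul]

theorem memℓp_twistedTranslate (ω : G → G → Circle) (g : G) (ξ : ellTwo G) :
    Memℓp (fun h : G => (ω h⁻¹ g : ℂ) * ξ (g⁻¹ * h)) 2 := by
  have h2 : 0 < (2 : ℝ≥0∞).toReal := by simp
  refine memℓp_gen ?_
  simp only [norm_twistedTranslate]
  exact (Equiv.mulLeft g⁻¹).summable_iff (f := fun h => ‖ξ h‖ ^ (2 : ℝ≥0∞).toReal) |>.2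
    ((lp.memℓp ξ).summable h2)

/-- The `ω`-twisted left regular representation, as a linear isometry of `ℓ²(G)`:
`(λ(g) ξ)(h) = ω(h⁻¹, g) ξ(g⁻¹ h)`. -/
noncomputable def twistedLeftRegularIsometry (ω : G → G → Circle) (g : G) :
    ellTwo G →ₗᵢ[ℂ] ellTwo G where
  toFun ξ := ⟨fun h => (ω h⁻¹ g : ℂ) * ξ (g⁻¹ * h), memℓp_twistedTranslate ω g ξ⟩
  map_add' ξ η := by
    ext h
    exact mul_add _ _ _
  map_smul' c ξ := by
    ext h
    simp [mul_left_comm]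
  norm_map' ξ := by
    have h2 : 0 < (2 : ℝ≥0∞).toReal := by simp
    change ‖(⟨fun h => (ω h⁻¹ g : ℂ) * ξ (g⁻¹ * h), memℓp_twistedTranslate ω g ξ⟩ : ellTwo G)‖
      = ‖ξ‖
    rw [lp.norm_eq_tsum_rpow h2, lp.norm_eq_tsum_rpow h2]
    simp only [norm_twistedTranslate]
    congr 1
    exact (Equiv.mulLeft g⁻¹).tsum_eq (fun h => ‖ξ h‖ ^ (2 : ℝ≥0∞).toReal)

/-- The operators `λ(g) ∈ B(ℓ²(G))` of the `ω`-twisted left regular representation. -/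
noncomputable def twistedLeftRegular (ω : G → G → Circle) (g : G) : ellTwo G →L[ℂ] ellTwo G :=
  (twistedLeftRegularIsometry ω g).toContinuousLinearMap

theorem twistedLeftRegular_apply (ω : G → G → Circle) (g : G) (ξ : ellTwo G) (h : G) :
    twistedLeftRegular ω g ξ h = (ω h⁻¹ g : ℂ) * ξ (g⁻¹ * h) :=
  rfl

/-- `C_r^*(G, ω)`: the norm-closed unital star subalgebra of `B(ℓ²(G))` generated by the
operators `λ(g)`, `g ∈ G`. -/
noncomputable def twistedReducedCStarAlgebra (ω : G → G → Circle) :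
    StarSubalgebra ℂ (ellTwo G →L[ℂ] ellTwo G) :=
  (StarAlgebra.adjoin ℂ (Set.range (twistedLeftRegular ω))).topologicalClosure

end Twisted

/-! ### Simplicity and tracial states -/

/-- Simplicity of a unital C*-algebra: it is nonzero and its only closed two-sided ideals are
`{0}` and the whole algebra. -/
def IsSimpleCStarAlgebra (A : Type*) [Ring A] [TopologicalSpace A] : Prop :=
  Nontrivial A ∧ ∀ I : TwoSidedIdeal A, IsClosed (I : Set A) → I = ⊥ ∨ I = ⊤

/-- Tracial states of a unital C*-algebra: positive linear functionals `τ` with `τ(1) = 1` and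
`τ(ab) = τ(ba)`. -/
structure IsTracialState {A : Type*} [Ring A] [StarRing A] [Algebra ℂ A] (τ : A →ₗ[ℂ] ℂ) :
    Prop where
  nonneg : ∀ a : A, 0 ≤ τ (star a * a)
  map_one : τ 1 = 1
  tracial : ∀ a b : A, τ (a * b) = τ (b * a)

/-! ### Operators on `ℓ²(G)` concentrated near a set -/

section Restriction

variable {G : Type*}

/-! The proof is Powers' averaging argument. Let `τ` be the canonical trace, x ↦ ⟨δ_e, x δ_e⟩. It
suffices to bring every a arbitrarily close to `τ a • 1` by iterated averages of conjugates by the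
unitaries λ(h) (the Dixmier property). Such averages fix every trace and preserve every ideal, so
uniqueness follows by continuity of traces (`IsTracialState.eq_of_dixmier`), and simplicity from
faithfulness of `τ` (`isSimpleCStarAlgebra_of_dixmier`).

Averages are contractive and the λ(g) span a dense subspace, so only finitely many λ(f) with f ≠ e
need to be shrunk at once (`dixmier_of_finset`). If T_j is h_j F h_j⁻¹-large, conjugating a
combination of λ(f), f ∈ F, by λ(h_j) gives an operator mapping functions supported off T_j into
functions supported in T_j. When each point lies in at most n of the T_j, Cauchy–Schwarz bounds the
average of N such operators of norm at most C by 2C√(n/N) (`ellTwo.norm_sum_le_of_mapsComplTo`).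
Powers sets give n = 1; under (P_com) n is the number of sets D_k. The cocycle only contributes
scalars of modulus one. -/

theorem ellTwo.hasSum_norm_sq (ξ : ellTwo G) : HasSum (fun x => ‖ξ x‖ ^ 2) (‖ξ‖ ^ 2) := by
  simpa using lp.hasSum_norm (p := 2) (by simp) ξ

theorem memℓp_indicator (T : Set G) (ξ : ellTwo G) : Memℓp (T.indicator (ξ : G → ℂ)) 2 := by
  classical
  refine memℓp_gen (Summable.of_nonneg_of_le (fun x => by positivity) (fun x => ?_)
    ((lp.memℓp ξ).summable (by simp)))
  by_cases hx : x ∈ T <;> simp [hx]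

/-- The orthogonal projection of `ℓ²(G)` onto the functions supported in `T`. -/
noncomputable def ellTwo.restrict (T : Set G) (ξ : ellTwo G) : ellTwo G :=
  ⟨T.indicator (ξ : G → ℂ), memℓp_indicator T ξ⟩

namespace ellTwo

theorem restrict_apply (T : Set G) (ξ : ellTwo G) (x : G) :
    restrict T ξ x = T.indicator (ξ : G → ℂ) x := rfl

theorem restrict_add_restrict_compl (T : Set G) (ξ : ellTwo G) :
    restrict T ξ + restrict Tᶜ ξ = ξ := by
  ext x
  exact congrFun (Set.indicator_self_add_compl T (ξ : G → ℂ)) x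

theorem norm_restrict_le (T : Set G) (ξ : ellTwo G) : ‖restrict T ξ‖ ≤ ‖ξ‖ := by
  classical
  refine lp.norm_mono (by simp) fun x => ?_
  rw [restrict_apply]
  exact norm_indicator_le_norm_self _ _

theorem inner_restrict_right {T : Set G} {ξ : ellTwo G} (hξ : ∀ x ∉ T, ξ x = 0) (η : ellTwo G) :
    inner ℂ ξ (restrict T η) = inner ℂ ξ η := by
  classical
  rw [lp.inner_eq_tsum, lp.inner_eq_tsum]
  refine tsum_congr fun x => ?_
  by_cases hx : x ∈ T
  · simp [restrict_apply, hx]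
  · simp [hξ x hx]

/-- `y` maps functions supported off `T` to functions supported in `T`. -/
def MapsComplTo (T : Set G) (y : ellTwo G →L[ℂ] ellTwo G) : Prop :=
  ∀ ξ : ellTwo G, (∀ x ∈ T, ξ x = 0) → ∀ x ∉ T, y ξ x = 0

/-- Split ξ along T. The part off T is sent into T, so it only pairs with the restriction of η. Each
term thus contains a restriction to T, which is what gains over the trivial bound after summing over
many sets. -/
theorem MapsComplTo.norm_inner_le {T : Set G} {y : ellTwo G →L[ℂ] ellTwo G}
    (hy : MapsComplTo T y) {C : ℝ} (hC : ‖y‖ ≤ C) (ξ η : ellTwo G) :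
    ‖inner ℂ (y ξ) η‖ ≤ C * (‖restrict T ξ‖ * ‖η‖ + ‖ξ‖ * ‖restrict T η‖) := by
  have hC0 : 0 ≤ C := (norm_nonneg y).trans hC
  have h1 : inner ℂ (y ξ) η = inner ℂ (y (restrict T ξ)) η +
      inner ℂ (y (restrict Tᶜ ξ)) (restrict T η) := by
    rw [inner_restrict_right, ← inner_add_left, ← map_add, restrict_add_restrict_compl]
    refine hy _ fun x hx => ?_
    simp [restrict_apply, hx]
  have hb : ∀ ζ, ‖y ζ‖ ≤ C * ‖ζ‖ := fun ζ => y.le_of_opNorm_le hC ζ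
  rw [h1, mul_add]
  refine (norm_add_le _ _).trans (add_le_add ?_ ?_)
  · refine (norm_inner_le_norm _ _).trans ?_
    rw [← mul_assoc]
    exact mul_le_mul_of_nonneg_right (hb _) (norm_nonneg _)
  · refine (norm_inner_le_norm _ _).trans ?_
    rw [← mul_assoc]
    refine mul_le_mul_of_nonneg_right ((hb _).trans ?_) (norm_nonneg _)
    exact mul_le_mul_of_nonneg_left (norm_restrict_le _ _) hC0

open Classical in
theorem sum_norm_sq_restrict_le {N n : ℕ} (T : Fin N → Set G)
    (hT : ∀ x, (Finset.univ.filter fun j => x ∈ T j).card ≤ n) (ξ : ellTwo G) :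
    ∑ j, ‖restrict (T j) ξ‖ ^ 2 ≤ n * ‖ξ‖ ^ 2 := by
  refine hasSum_le (fun x => ?_) (hasSum_sum fun j _ => hasSum_norm_sq (restrict (T j) ξ))
    ((hasSum_norm_sq ξ).mul_left (n : ℝ))
  have h : ∀ j, ‖restrict (T j) ξ x‖ ^ 2 = if x ∈ T j then ‖ξ x‖ ^ 2 else 0 := fun j => by
    by_cases hx : x ∈ T j <;> simp [restrict_apply, hx]
  simp only [h]
  rw [← Finset.sum_filter, Finset.sum_const, nsmul_eq_mul]
  exact mul_le_mul_of_nonneg_right (by exact_mod_cast hT x) (by positivity)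

-- Cauchy–Schwarz over the N indices. The growth is √N, which dividing by N in an average turns into
-- decay.
open Classical in
theorem sum_norm_restrict_le {N n : ℕ} (T : Fin N → Set G)
    (hT : ∀ x, (Finset.univ.filter fun j => x ∈ T j).card ≤ n) (ξ : ellTwo G) :
    ∑ j, ‖restrict (T j) ξ‖ ≤ √(N * n) * ‖ξ‖ := by
  refine le_of_sq_le_sq ?_ (by positivity)
  rw [mul_pow, Real.sq_sqrt (by positivity), mul_assoc]
  refine sq_sum_le_card_mul_sum_sq.trans ?_
  rw [Finset.card_univ, Fintype.card_fin]
  exact mul_le_mul_of_nonneg_left (sum_norm_sq_restrict_le T hT ξ) (by positivity)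

open Classical in
/-- Operators `y j` concentrated near sets `T j` of bounded multiplicity are almost orthogonal. -/
theorem norm_sum_le_of_mapsComplTo {N n : ℕ} (T : Fin N → Set G)
    (hT : ∀ x, (Finset.univ.filter fun j => x ∈ T j).card ≤ n)
    (y : Fin N → ellTwo G →L[ℂ] ellTwo G) (hy : ∀ j, MapsComplTo (T j) (y j)) {C : ℝ}
    (hC0 : 0 ≤ C) (hC : ∀ j, ‖y j‖ ≤ C) : ‖∑ j, y j‖ ≤ 2 * C * √(N * n) := by
  have key : ∀ ξ η : ellTwo G,
      ‖inner ℂ ((∑ j, y j) ξ) η‖ ≤ 2 * C * √(N * n) * ‖ξ‖ * ‖η‖ := fun ξ η => by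
    rw [sum_apply, sum_inner]
    calc _ ≤ ∑ j, ‖inner ℂ (y j ξ) η‖ := norm_sum_le _ _
      _ ≤ ∑ j, C * (‖restrict (T j) ξ‖ * ‖η‖ + ‖ξ‖ * ‖restrict (T j) η‖) :=
        Finset.sum_le_sum fun j _ => (hy j).norm_inner_le (hC j) ξ η
      _ = C * ((∑ j, ‖restrict (T j) ξ‖) * ‖η‖ + ‖ξ‖ * ∑ j, ‖restrict (T j) η‖) := by
        rw [← Finset.mul_sum, Finset.sum_add_distrib, Finset.sum_mul, Finset.mul_sum]
      _ ≤ C * ((√(N * n) * ‖ξ‖) * ‖η‖ + ‖ξ‖ * (√(N * n) * ‖η‖)) := by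
        gcongr <;> exact sum_norm_restrict_le T hT _
      _ = _ := by ring
  refine ContinuousLinearMap.opNorm_le_bound _ (by positivity) fun ξ => ?_
  -- Take η to be the image of ξ in `key` and cancel one factor of its norm.
  rcases (norm_nonneg ((∑ j, y j) ξ)).eq_or_lt' with h0 | h0
  · rw [h0]; positivity
  · refine le_of_mul_le_mul_right ?_ h0
    refine le_trans (le_of_eq ?_) (key ξ ((∑ j, y j) ξ))
    rw [inner_self_eq_norm_sq_to_K]
    simp [sq]

end ellTwo

end Restriction

/-! ### The twisted left regular representation -/

section Regular

variable {G : Type*} [Group G] {ω : G → G → Circle}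

theorem IsCircleTwoCocycle.map_one_right (hω : IsCircleTwoCocycle ω) (g : G) :
    ω g 1 = ω 1 1 := by
  have h := hω g 1 1
  simp only [mul_one] at h
  exact mul_right_cancel h

theorem twistedLeftRegular_mul (hω : IsCircleTwoCocycle ω) (g h : G) :
    twistedLeftRegular ω g * twistedLeftRegular ω h =
      (ω g h : ℂ) • twistedLeftRegular ω (g * h) := by
  ext ξ k
  have h1 := congrArg ((↑) : Circle → ℂ) (hω k⁻¹ g h)
  rw [Circle.coe_mul, Circle.coe_mul] at h1
  change (ω k⁻¹ g : ℂ) * ((ω (g⁻¹ * k)⁻¹ h : ℂ) * ξ (h⁻¹ * (g⁻¹ * k))) =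
    (ω g h : ℂ) * ((ω k⁻¹ (g * h) : ℂ) * ξ ((g * h)⁻¹ * k))
  rw [mul_inv_rev, inv_inv, ← mul_assoc, ← mul_assoc, mul_inv_rev, mul_assoc h⁻¹, h1,
    mul_assoc (ω g h : ℂ)]

theorem twistedLeftRegular_one (hω : IsCircleTwoCocycle ω) :
    twistedLeftRegular ω (1 : G) = (ω 1 1 : ℂ) • 1 := by
  ext ξ k
  rw [twistedLeftRegular_apply, hω.map_one_right, inv_one, one_mul]
  rfl

theorem star_mul_twistedLeftRegular (ω : G → G → Circle) (g : G) :
    star (twistedLeftRegular ω g) * twistedLeftRegular ω g = 1 :=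
  (ContinuousLinearMap.norm_map_iff_adjoint_comp_self _).1
    (twistedLeftRegularIsometry ω g).norm_map

theorem star_twistedLeftRegular (hω : IsCircleTwoCocycle ω) (g : G) :
    star (twistedLeftRegular ω g) =
      ((ω g g⁻¹ * ω 1 1 : Circle) : ℂ)⁻¹ • twistedLeftRegular ω g⁻¹ := by
  have h := congrArg (star (twistedLeftRegular ω g) * ·) (twistedLeftRegular_mul hω g g⁻¹)
  simp only [← mul_assoc, star_mul_twistedLeftRegular, one_mul, mul_inv_cancel,
    twistedLeftRegular_one hω, smul_smul, mul_smul_comm, mul_one, ← Circle.coe_mul] at h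
  rw [h, smul_smul, inv_mul_cancel₀ (Circle.coe_ne_zero _), one_smul]

/-- An isometry only has its adjoint as a left inverse; here the adjoint is a multiple of λ(g⁻¹),
which makes it a right inverse too. -/
theorem twistedLeftRegular_mul_star (hω : IsCircleTwoCocycle ω) (g : G) :
    twistedLeftRegular ω g * star (twistedLeftRegular ω g) = 1 := by
  rw [star_twistedLeftRegular hω, mul_smul_comm, twistedLeftRegular_mul hω, mul_inv_cancel,
    twistedLeftRegular_one hω, smul_smul, smul_smul, mul_assoc, ← Circle.coe_mul]
  exact (congrArg (· • (1 : ellTwo G →L[ℂ] ellTwo G))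
    (inv_mul_cancel₀ (Circle.coe_ne_zero _))).trans (one_smul ℂ _)

theorem exists_conj_twistedLeftRegular (hω : IsCircleTwoCocycle ω) (h g : G) :
    ∃ c : ℂ, twistedLeftRegular ω h * twistedLeftRegular ω g * star (twistedLeftRegular ω h) =
      c • twistedLeftRegular ω (h * g * h⁻¹) := by
  rw [star_twistedLeftRegular hω, twistedLeftRegular_mul hω, mul_smul_comm, smul_mul_assoc,
    twistedLeftRegular_mul hω, smul_smul, smul_smul]
  exact ⟨_, rfl⟩

/-- If λ(m)ξ is nonzero at x then m⁻¹x ∉ T, and largeness puts x = m(m⁻¹x) in T. -/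
theorem IsLargeFor.mapsComplTo {M T : Set G} (hT : IsLargeFor M T)
    {y : ellTwo G →L[ℂ] ellTwo G} (hy : y ∈ Submodule.span ℂ (twistedLeftRegular ω '' M)) :
    ellTwo.MapsComplTo T y := by
  intro ξ hξ x hx
  induction hy using Submodule.span_induction with
  | mem y hy =>
    obtain ⟨m, hm, rfl⟩ := hy
    rw [twistedLeftRegular_apply]
    by_cases h : m⁻¹ * x ∈ T
    · rw [hξ _ h, mul_zero]
    · exact absurd (hT m hm ⟨m⁻¹ * x, h, by simp⟩) hx
  | zero => rfl
  | add y z _ _ hy hz =>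
    change y ξ x + z ξ x = 0
    rw [hy, hz, add_zero]
  | smul c y _ hy =>
    change c * y ξ x = 0
    rw [hy, mul_zero]

/-- Products and adjoints of the λ(g) are multiples of some λ(h), so their linear span is already a
unital star algebra. -/
theorem adjoin_range_twistedLeftRegular (hω : IsCircleTwoCocycle ω)
    {x : ellTwo G →L[ℂ] ellTwo G}
    (hx : x ∈ StarAlgebra.adjoin ℂ (Set.range (twistedLeftRegular ω))) :
    x ∈ Submodule.span ℂ (Set.range (twistedLeftRegular ω)) := by
  induction hx using StarAlgebra.adjoin_induction with
  | mem x hx => exact Submodule.subset_span hx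
  | algebraMap r =>
    have h : (1 : ellTwo G →L[ℂ] ellTwo G) = (ω 1 1 : ℂ)⁻¹ • twistedLeftRegular ω (1 : G) := by
      rw [twistedLeftRegular_one hω, smul_smul, inv_mul_cancel₀ (Circle.coe_ne_zero _), one_smul]
    rw [Algebra.algebraMap_eq_smul_one, h]
    exact Submodule.smul_mem _ _ (Submodule.smul_mem _ _ (Submodule.subset_span ⟨1, rfl⟩))
  | add x y _ _ hx hy => exact add_mem hx hy
  | mul x y _ _ hx hy =>
    refine Submodule.span_induction₂ (p := fun x y _ _ => x * y ∈ _) ?_ ?_ ?_ ?_ ?_ ?_ ?_ hx hy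
    · rintro _ _ ⟨g, rfl⟩ ⟨h, rfl⟩
      rw [twistedLeftRegular_mul hω]
      exact Submodule.smul_mem _ _ (Submodule.subset_span ⟨_, rfl⟩)
    · intro y _; rw [zero_mul]; exact zero_mem _
    · intro x _; rw [mul_zero]; exact zero_mem _
    · intro x y z _ _ _ h1 h2; rw [add_mul]; exact add_mem h1 h2
    · intro x y z _ _ _ h1 h2; rw [mul_add]; exact add_mem h1 h2
    · intro r x y _ _ h; rw [smul_mul_assoc]; exact Submodule.smul_mem _ _ h
    · intro r x y _ _ h; rw [mul_smul_comm]; exact Submodule.smul_mem _ _ h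
  | star x hx₀ hx =>
    clear hx₀
    induction hx using Submodule.span_induction with
    | mem x hx =>
      obtain ⟨g, rfl⟩ := hx
      rw [star_twistedLeftRegular hω]
      exact Submodule.smul_mem _ _ (Submodule.subset_span ⟨_, rfl⟩)
    | zero => rw [star_zero]; exact zero_mem _
    | add x y _ _ hx hy => rw [star_add]; exact add_mem hx hy
    | smul c x _ hx => rw [star_smul]; exact Submodule.smul_mem _ _ hx

end Regular

/-! ### Averages of conjugates by unitaries -/

section Averages

variable {G A : Type*}

/-- The operator `x ↦ N⁻¹ ∑ v_j x v_j*`, for a finite non-empty family `v`. -/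
noncomputable def conjAverage [Ring A] [StarRing A] [Algebra ℂ A] {N : ℕ}
    (v : Fin (N + 1) → A) : Module.End ℂ A :=
  ((N + 1 : ℕ) : ℂ)⁻¹ • ∑ j, LinearMap.mulLeftRight ℂ (v j, star (v j))

theorem conjAverage_apply [Ring A] [StarRing A] [Algebra ℂ A] {N : ℕ}
    (v : Fin (N + 1) → A) (x : A) :
    conjAverage v x = ((N + 1 : ℕ) : ℂ)⁻¹ • ∑ j, v j * x * star (v j) := by
  simp [conjAverage]

/-- The operators obtained by iterating averages of conjugates by `u k`, `k ∈ K`. -/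
noncomputable def conjAverages [Ring A] [StarRing A] [Algebra ℂ A] (u : G → A) (K : Set G) :
    Submonoid (Module.End ℂ A) :=
  Submonoid.closure {φ | ∃ (N : ℕ) (h : Fin (N + 1) → G), (∀ j, h j ∈ K) ∧
    φ = conjAverage fun j => u (h j)}

section Algebraic

variable [Ring A] [StarRing A] [Algebra ℂ A] {u : G → A} {K : Set G}

theorem conjAverage_mem_conjAverages {N : ℕ} {h : Fin (N + 1) → G} (hK : ∀ j, h j ∈ K) :
    conjAverage (fun j => u (h j)) ∈ conjAverages u K :=
  Submonoid.subset_closure ⟨N, h, hK, rfl⟩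

theorem conjAverages_mono {L : Set G} (h : L ⊆ K) : conjAverages u L ≤ conjAverages u K :=
  Submonoid.closure_mono fun _ ⟨N, k, hk, e⟩ => ⟨N, k, fun j => h (hk j), e⟩

/-- A property of elements stable under averaging is stable under iterated averaging. -/
theorem conjAverages_induction {p : A → Prop}
    (hp : ∀ (N : ℕ) (h : Fin (N + 1) → G), (∀ j, h j ∈ K) → ∀ x, p x →
      p (conjAverage (fun j => u (h j)) x))
    {φ : Module.End ℂ A} (hφ : φ ∈ conjAverages u K) {x : A} (hx : p x) : p (φ x) := by
  induction hφ using Submonoid.closure_induction generalizing x with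
  | mem φ hφ =>
    obtain ⟨N, h, hK, rfl⟩ := hφ
    exact hp N h hK x hx
  | one => exact hx
  | mul φ ψ _ _ h1 h2 => exact h1 (h2 hx)

theorem conjAverages_apply_one (hu : ∀ g, u g ∈ unitary A) {φ : Module.End ℂ A}
    (hφ : φ ∈ conjAverages u K) : φ 1 = 1 := by
  refine conjAverages_induction (p := (· = 1)) (fun N h _ x hx => ?_) hφ rfl
  have h1 : ∀ j, u (h j) * star (u (h j)) = 1 := fun j => (Unitary.mem_iff.1 (hu _)).2
  rw [hx, conjAverage_apply]
  simp only [mul_one, h1, Finset.sum_const, Finset.card_univ, Fintype.card_fin]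
  rw [← Nat.cast_smul_eq_nsmul ℂ, smul_smul, inv_mul_cancel₀ (Nat.cast_ne_zero.2 N.succ_ne_zero),
    one_smul]

theorem conjAverages_apply_mem (I : TwoSidedIdeal A) {φ : Module.End ℂ A}
    (hφ : φ ∈ conjAverages u K) {x : A} (hx : x ∈ I) : φ x ∈ I := by
  refine conjAverages_induction (p := (· ∈ I)) (fun N h _ x hx => ?_) hφ hx
  -- The scalar is absorbed into a ring element `c • 1`, so that only closure under ring
  -- multiplication is needed.
  rw [conjAverage_apply, ← one_mul (∑ j, _), ← smul_mul_assoc]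
  refine I.mul_mem_left _ _ (sum_mem fun j _ => ?_)
  exact I.mul_mem_right _ _ (I.mul_mem_left _ _ hx)

theorem IsTracialState.apply_conjAverages {τ : A →ₗ[ℂ] ℂ} (hτ : IsTracialState τ)
    (hu : ∀ g, u g ∈ unitary A) {φ : Module.End ℂ A}
    (hφ : φ ∈ conjAverages u K) (x : A) : τ (φ x) = τ x := by
  refine conjAverages_induction (p := fun y => τ y = τ x) (fun N h _ y hy => ?_) hφ rfl
  have h1 : ∀ j, star (u (h j)) * u (h j) = 1 := fun j => (Unitary.mem_iff.1 (hu _)).1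
  rw [conjAverage_apply, map_smul, map_sum, ← hy]
  simp_rw [hτ.tracial _ (star _), ← mul_assoc, h1, one_mul]
  rw [Finset.sum_const, Finset.card_univ, Fintype.card_fin, nsmul_eq_mul, smul_eq_mul,
    inv_mul_cancel_left₀ (Nat.cast_ne_zero.2 N.succ_ne_zero)]

/-- Iterated averages of `u f` are combinations of the `u (a f a⁻¹)`. -/
theorem exists_mem_span_conjugatesBy [Group G]
    (hconj : ∀ h g, ∃ c : ℂ, u h * u g * star (u h) = c • u (h * g * h⁻¹))
    (L : Subgroup G) {φ : Module.End ℂ A} (hφ : φ ∈ conjAverages u (L : Set G)) (f : G) :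
    ∃ M : Set G, M.Finite ∧ M.Nonempty ∧ M ⊆ L ∧
      φ (u f) ∈ Submodule.span ℂ (u '' conjugatesBy f M) := by
  refine conjAverages_induction (p := fun x => ∃ M : Set G, M.Finite ∧ M.Nonempty ∧ M ⊆ L ∧
      x ∈ Submodule.span ℂ (u '' conjugatesBy f M)) ?_ hφ
    ⟨{1}, Set.finite_singleton 1, Set.singleton_nonempty 1, by simp [L.one_mem],
      Submodule.subset_span ⟨f, ⟨1, rfl, by simp⟩, rfl⟩⟩
  rintro N h hL x ⟨M, hM, ⟨m, hm⟩, hML, hx⟩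
  -- Conjugating a f a⁻¹ by h_j gives (h_j a) f (h_j a)⁻¹, so the conjugating elements become the
  -- products h_j a.
  refine ⟨Set.range h * M, (Set.finite_range h).mul hM, ⟨h 0 * m, Set.mul_mem_mul ⟨0, rfl⟩ hm⟩,
    ?_, ?_⟩
  · rintro _ ⟨_, ⟨j, rfl⟩, b, hb, rfl⟩
    exact L.mul_mem (hL j) (hML hb)
  · rw [conjAverage_apply]
    refine Submodule.smul_mem _ _ (sum_mem fun j _ => ?_)
    induction hx using Submodule.span_induction with
    | mem x hx =>
      obtain ⟨_, ⟨a, ha, rfl⟩, rfl⟩ := hx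
      obtain ⟨c, hc⟩ := hconj (h j) (a * f * a⁻¹)
      rw [hc]
      refine Submodule.smul_mem _ _ (Submodule.subset_span ⟨_, ⟨h j * a, ?_, rfl⟩, ?_⟩)
      · exact Set.mul_mem_mul ⟨j, rfl⟩ ha
      · simp [mul_assoc]
    | zero => simp
    | add x y _ _ hx hy => rw [mul_add, add_mul]; exact add_mem hx hy
    | smul c x _ hx => rw [mul_smul_comm, smul_mul_assoc]; exact Submodule.smul_mem _ _ hx

end Algebraic

theorem norm_conj_unitary [NormedRing A] [StarRing A] [CStarRing A] {v : A}
    (hv : v ∈ unitary A) (x : A) : ‖v * x * star v‖ = ‖x‖ := by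
  rw [CStarRing.norm_mul_mem_unitary _ (Unitary.star_mem hv), CStarRing.norm_mem_unitary_mul _ hv]

theorem norm_conjAverages_apply_le [NormedRing A] [StarRing A] [CStarRing A] [NormedAlgebra ℂ A]
    {u : G → A} {K : Set G} (hu : ∀ g, u g ∈ unitary A) {φ : Module.End ℂ A}
    (hφ : φ ∈ conjAverages u K) (x : A) : ‖φ x‖ ≤ ‖x‖ := by
  refine conjAverages_induction (p := fun y => ‖y‖ ≤ ‖x‖) (fun N h _ y hy => ?_) hφ le_rfl
  rw [conjAverage_apply, norm_smul, norm_inv, Complex.norm_natCast,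
    inv_mul_le_iff₀ (Nat.cast_pos.2 N.succ_pos)]
  refine (norm_sum_le _ _).trans ?_
  simp only [norm_conj_unitary (hu _), Finset.sum_const, Finset.card_univ, Fintype.card_fin,
    nsmul_eq_mul]
  exact mul_le_mul_of_nonneg_left hy (Nat.cast_nonneg _)

end Averages

/-! ### The Dixmier property and its consequences -/

section Dixmier

variable {G A : Type*} [CStarAlgebra A]

theorem IsTracialState.continuous {τ : A →ₗ[ℂ] ℂ} (hτ : IsTracialState τ) : Continuous τ := by
  let _ := CStarAlgebra.spectralOrder A
  have := CStarAlgebra.spectralOrderedRing A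
  have hpos : ∀ x, 0 ≤ x → 0 ≤ τ x := fun x hx => by
    obtain ⟨b, rfl⟩ := CStarAlgebra.nonneg_iff_eq_star_mul_self.1 hx
    exact hτ.nonneg b
  exact map_continuous (PositiveLinearMap.mk₀ τ hpos)

variable {u : G → A} {K : Set G} {τ : A →ₗ[ℂ] ℂ}

/-- A trace σ takes the same value on a and on its averages, while these converge to `τ a • 1`,
where σ is `τ a`. -/
theorem IsTracialState.eq_of_dixmier (hu : ∀ g, u g ∈ unitary A)
    (hD : ∀ a : A, ∀ ε > 0, ∃ φ ∈ conjAverages u K, ‖φ a - τ a • 1‖ < ε)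
    {σ : A →ₗ[ℂ] ℂ} (hσ : IsTracialState σ) : σ = τ := by
  ext a
  choose φ hφ hφa using fun n : ℕ => hD a (1 / (n + 1)) Nat.one_div_pos_of_nat
  have h1 : Filter.Tendsto (fun n => φ n a) Filter.atTop (nhds (τ a • 1)) :=
    tendsto_iff_norm_sub_tendsto_zero.2
      (squeeze_zero (fun _ => norm_nonneg _) (fun n => (hφa n).le)
        tendsto_one_div_add_atTop_nhds_zero_nat)
  have h2 := (hσ.continuous.tendsto _).comp h1
  have h3 : σ ∘ (fun n => φ n a) = fun _ => σ a :=
    funext fun n => hσ.apply_conjAverages hu (hφ n) a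
  rw [h3] at h2
  simpa [hσ.map_one] using tendsto_nhds_unique tendsto_const_nhds h2

/-- A nonzero a in I gives star a * a in I with nonzero trace; an average of it stays in I and is
close to a nonzero scalar, hence invertible. -/
theorem isSimpleCStarAlgebra_of_dixmier [Nontrivial A] (hτ : ∀ a, τ (star a * a) = 0 → a = 0)
    (hD : ∀ a : A, ∀ ε > 0, ∃ φ ∈ conjAverages u K, ‖φ a - τ a • 1‖ < ε) :
    IsSimpleCStarAlgebra A := by
  refine ⟨inferInstance, fun I _ => or_iff_not_imp_left.2 fun hI => ?_⟩
  obtain ⟨a, haI, ha⟩ : ∃ a ∈ I, a ≠ 0 := by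
    by_contra! h
    exact hI (TwoSidedIdeal.ext fun x => ⟨fun hx => (h x hx) ▸ zero_mem _,
      fun hx => ((TwoSidedIdeal.mem_bot A).1 hx) ▸ zero_mem _⟩)
  set t := τ (star a * a) with ht
  have ht0 : t ≠ 0 := fun h => ha (hτ a h)
  -- With tolerance ‖t‖, dividing by t leaves an element at distance less than 1 from the identity.
  obtain ⟨φ, hφ, hφa⟩ := hD (star a * a) ‖t‖ (norm_pos_iff.2 ht0)
  have hmem : φ (star a * a) ∈ I := conjAverages_apply_mem I hφ (I.mul_mem_left _ _ haI)
  have hunit : IsUnit (1 - (1 - t⁻¹ • φ (star a * a))) := by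
    refine isUnit_one_sub_of_norm_lt_one ?_
    have h : 1 - t⁻¹ • φ (star a * a) = -(t⁻¹ • (φ (star a * a) - t • 1)) := by
      rw [smul_sub, smul_smul, inv_mul_cancel₀ ht0, one_smul, neg_sub]
    rw [h, norm_neg, norm_smul, norm_inv, inv_mul_lt_iff₀ (norm_pos_iff.2 ht0), mul_one]
    exact hφa
  rw [sub_sub_cancel] at hunit
  obtain ⟨b, hb⟩ := hunit.exists_left_inv
  refine I.one_mem_iff.1 ?_
  rw [← hb, mul_smul_comm, ← smul_mul_assoc]
  exact I.mul_mem_left _ _ hmem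

/-- The Dixmier property for `A` follows from its validity for finitely many `u g` at a time, when
these elements span a dense subspace. -/
theorem dixmier_of_finset (hu : ∀ g, u g ∈ unitary A) (hτ : IsTracialState τ)
    (hdense : Dense (Submodule.span ℂ (Set.range u) : Set A))
    (hD : ∀ s : Finset G, ∀ ε > 0, ∃ φ ∈ conjAverages u K, ∀ g ∈ s, ‖φ (u g) - τ (u g) • 1‖ < ε)
    (a : A) {ε : ℝ} (hε : 0 < ε) : ∃ φ ∈ conjAverages u K, ‖φ a - τ a • 1‖ < ε := by
  have hspan : ∀ b ∈ Submodule.span ℂ (Set.range u), ∀ ε > 0,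
      ∃ φ ∈ conjAverages u K, ‖φ b - τ b • 1‖ < ε := by
    intro b hb ε hε
    obtain ⟨c, rfl⟩ := Finsupp.mem_span_range_iff_exists_finsupp.1 hb
    set S := ∑ g ∈ c.support, ‖c g‖ with hS
    have hS0 : 0 ≤ S := Finset.sum_nonneg fun _ _ => norm_nonneg _
    obtain ⟨φ, hφ, h⟩ := hD c.support (ε / (S + 1)) (by positivity)
    refine ⟨φ, hφ, ?_⟩
    have e : φ (c.sum fun g r => r • u g) - τ (c.sum fun g r => r • u g) • 1 =
        ∑ g ∈ c.support, c g • (φ (u g) - τ (u g) • 1) := by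
      simp only [Finsupp.sum, map_sum, map_smul, Finset.sum_smul, smul_sub, smul_smul,
        Finset.sum_sub_distrib, smul_eq_mul]
    rw [e]
    calc _ ≤ ∑ g ∈ c.support, ‖c g‖ * (ε / (S + 1)) := by
          refine (norm_sum_le _ _).trans (Finset.sum_le_sum fun g hg => ?_)
          rw [norm_smul]
          exact mul_le_mul_of_nonneg_left (h g hg).le (norm_nonneg _)
      _ = S * (ε / (S + 1)) := by rw [← Finset.sum_mul]
      _ < ε := by
          rw [← mul_div_assoc, div_lt_iff₀ (by positivity)]
          linarith
  have hcont := hτ.continuous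
  have hnhds : {b | ‖a - b‖ < ε / 3 ∧ ‖(τ a - τ b) • (1 : A)‖ < ε / 3} ∈ nhds a := by
    refine Filter.inter_mem ?_ ?_
    · have : Continuous fun b => ‖a - b‖ := by fun_prop
      exact this.tendsto a (Iio_mem_nhds (by simpa using by positivity))
    · have : Continuous fun b => ‖(τ a - τ b) • (1 : A)‖ := by fun_prop
      exact this.tendsto a (Iio_mem_nhds (by simpa using by positivity))
  obtain ⟨b, hb, hb1, hb2⟩ := hdense.inter_nhds_nonempty hnhds
  obtain ⟨φ, hφ, h⟩ := hspan b hb (ε / 3) (by positivity)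
  refine ⟨φ, hφ, ?_⟩
  -- The first term is small whatever `φ` is, by contractivity; this matters because `φ` is chosen
  -- after b.
  have e : φ a - τ a • 1 = φ (a - b) + (φ b - τ b • 1) - (τ a - τ b) • 1 := by
    rw [map_sub, sub_smul]; abel
  rw [e]
  have h1 := norm_sub_le (φ (a - b) + (φ b - τ b • 1)) ((τ a - τ b) • 1)
  have h2 := norm_add_le (φ (a - b)) (φ b - τ b • 1)
  have h3 := norm_conjAverages_apply_le hu hφ (a - b)
  linarith

end Dixmier

/-! ### The canonical trace on `C_r^*(G, ω)` -/

section TwistedAlgebra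

variable {G : Type*} [Group G] {ω : G → G → Circle}

namespace twistedReducedCStarAlgebra

/-- `C_r^*(G, ω)` as an abstract C*-algebra. -/
noncomputable abbrev cstarAlgebra (ω : G → G → Circle) :
    CStarAlgebra (twistedReducedCStarAlgebra ω) :=
  StarSubalgebra.cstarAlgebra _ (h_closed := StarSubalgebra.isClosed_topologicalClosure _)

/-- The operator `λ(g)` as an element of `C_r^*(G, ω)`. -/
noncomputable def gen (ω : G → G → Circle) (g : G) : twistedReducedCStarAlgebra ω :=
  ⟨twistedLeftRegular ω g, StarSubalgebra.le_topologicalClosure _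
    (StarAlgebra.subset_adjoin ℂ _ ⟨g, rfl⟩)⟩

theorem coe_gen (g : G) : (gen ω g : ellTwo G →L[ℂ] ellTwo G) = twistedLeftRegular ω g := rfl

theorem gen_mem_unitary (hω : IsCircleTwoCocycle ω) (g : G) :
    gen ω g ∈ unitary (twistedReducedCStarAlgebra ω) :=
  Unitary.mem_iff.2 ⟨Subtype.ext (star_mul_twistedLeftRegular ω g),
    Subtype.ext (twistedLeftRegular_mul_star hω g)⟩

theorem gen_mul (hω : IsCircleTwoCocycle ω) (g h : G) :
    gen ω g * gen ω h = (ω g h : ℂ) • gen ω (g * h) :=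
  Subtype.ext (twistedLeftRegular_mul hω g h)

theorem gen_one (hω : IsCircleTwoCocycle ω) : gen ω (1 : G) = (ω 1 1 : ℂ) • 1 :=
  Subtype.ext (twistedLeftRegular_one hω)

theorem exists_conj_gen (hω : IsCircleTwoCocycle ω) (h g : G) :
    ∃ c : ℂ, gen ω h * gen ω g * star (gen ω h) = c • gen ω (h * g * h⁻¹) :=
  let ⟨c, hc⟩ := exists_conj_twistedLeftRegular hω h g
  ⟨c, Subtype.ext hc⟩

theorem coe_mem_span {M : Set G} {x : twistedReducedCStarAlgebra ω}
    (hx : x ∈ Submodule.span ℂ (gen ω '' M)) :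
    (x : ellTwo G →L[ℂ] ellTwo G) ∈ Submodule.span ℂ (twistedLeftRegular ω '' M) := by
  have h := Submodule.mem_map_of_mem
    (f := (twistedReducedCStarAlgebra ω).subtype.toAlgHom.toLinearMap) hx
  rw [Submodule.map_span, ← Set.image_comp] at h
  exact h

theorem dense_span_gen (hω : IsCircleTwoCocycle ω) :
    Dense (Submodule.span ℂ (Set.range (gen ω)) : Set (twistedReducedCStarAlgebra ω)) := by
  intro x
  rw [closure_subtype]
  refine closure_mono (fun y hy => ?_) x.2
  have h := adjoin_range_twistedLeftRegular hω hy
  have e : Set.range (twistedLeftRegular ω) =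
      (twistedReducedCStarAlgebra ω).subtype.toAlgHom.toLinearMap '' Set.range (gen ω) := by
    rw [← Set.range_comp]; rfl
  rw [e, ← Submodule.map_span] at h
  exact h

open Classical in
/-- The vector `δ_e`. -/
noncomputable def delta (G : Type*) [Group G] : ellTwo G := lp.single 2 1 (1 : ℂ)

open Classical in
theorem delta_apply (g : G) : delta G g = if g = 1 then 1 else 0 := by
  rw [delta, lp.single_apply, Pi.single_apply]

/-- The canonical trace `x ↦ ⟨δ_e, x δ_e⟩`. -/
noncomputable def trace (ω : G → G → Circle) : twistedReducedCStarAlgebra ω →ₗ[ℂ] ℂ where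
  toFun x := inner ℂ (delta G) ((x : ellTwo G →L[ℂ] ellTwo G) (delta G))
  map_add' x y := by simp
  map_smul' c x := by simp

theorem trace_apply (x : twistedReducedCStarAlgebra ω) :
    trace ω x = (x : ellTwo G →L[ℂ] ellTwo G) (delta G) 1 := by
  classical
  change inner ℂ (delta G) _ = _
  rw [delta, lp.inner_single_left]
  simp

theorem continuous_trace : Continuous (trace ω) := by
  change Continuous fun x : twistedReducedCStarAlgebra ω =>
    inner ℂ (delta G) ((x : ellTwo G →L[ℂ] ellTwo G) (delta G))
  fun_prop

theorem trace_gen_of_ne {g : G} (hg : g ≠ 1) : trace ω (gen ω g) = 0 := by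
  rw [trace_apply, coe_gen, twistedLeftRegular_apply, delta_apply, if_neg (by simpa using hg),
    mul_zero]

theorem trace_one : trace ω 1 = 1 := by
  rw [trace_apply]
  change delta G 1 = 1
  rw [delta_apply, if_pos rfl]

theorem trace_star_mul_self (x : twistedReducedCStarAlgebra ω) :
    trace ω (star x * x) = (‖(x : ellTwo G →L[ℂ] ellTwo G) (delta G)‖ ^ 2 : ℝ) := by
  change inner ℂ (delta G) (ContinuousLinearMap.adjoint (x : ellTwo G →L[ℂ] ellTwo G)
    ((x : ellTwo G →L[ℂ] ellTwo G) (delta G))) = _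
  rw [ContinuousLinearMap.adjoint_inner_right, inner_self_eq_norm_sq_to_K]
  simp

theorem trace_gen_mul_comm (hω : IsCircleTwoCocycle ω) (g h : G) :
    trace ω (gen ω g * gen ω h) = trace ω (gen ω h * gen ω g) := by
  by_cases hgh : g * h = 1
  · have hu := Unitary.mem_iff.1 (gen_mem_unitary hω g)
    have e : gen ω g * gen ω h = ((ω g h : ℂ) * ω 1 1) • 1 := by
      rw [gen_mul hω, hgh, gen_one hω, smul_smul]
    -- Conjugating the scalar λ(g)λ(h) by λ(g) avoids comparing ω(g,h) with ω(h,g).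
    have e2 : gen ω h * gen ω g = ((ω g h : ℂ) * ω 1 1) • 1 := by
      calc gen ω h * gen ω g = star (gen ω g) * (gen ω g * gen ω h) * gen ω g := by
            rw [← mul_assoc, hu.1, one_mul]
        _ = _ := by rw [e, mul_smul_comm, smul_mul_assoc, mul_one, hu.1]
    rw [e, e2]
  · have hhg : h * g ≠ 1 := fun h' => hgh (mul_eq_one_comm.1 h')
    rw [gen_mul hω, gen_mul hω, map_smul, map_smul, trace_gen_of_ne hgh, trace_gen_of_ne hhg,
      smul_zero, smul_zero]

theorem trace_mul_comm (hω : IsCircleTwoCocycle ω) (x y : twistedReducedCStarAlgebra ω) :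
    trace ω (x * y) = trace ω (y * x) := by
  have hc1 : Continuous fun p : twistedReducedCStarAlgebra ω × twistedReducedCStarAlgebra ω =>
    trace ω (p.1 * p.2) := continuous_trace.comp (by fun_prop)
  have hc2 : Continuous fun p : twistedReducedCStarAlgebra ω × twistedReducedCStarAlgebra ω =>
    trace ω (p.2 * p.1) := continuous_trace.comp (by fun_prop)
  have h := hc1.ext_on ((dense_span_gen hω).prod (dense_span_gen hω)) hc2 ?_
  · exact congrFun h (x, y)
  rintro ⟨x, y⟩ ⟨hx, hy⟩
  dsimp only at hx hy ⊢
  refine Submodule.span_induction₂ (p := fun x y _ _ => trace ω (x * y) = trace ω (y * x))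
    ?_ ?_ ?_ ?_ ?_ ?_ ?_ hx hy
  · rintro _ _ ⟨g, rfl⟩ ⟨h, rfl⟩
    exact trace_gen_mul_comm hω g h
  · intro y _; rw [zero_mul, mul_zero]
  · intro y _; rw [zero_mul, mul_zero]
  · intro x y z _ _ _ h1 h2; rw [add_mul, mul_add, map_add, map_add, h1, h2]
  · intro x y z _ _ _ h1 h2; rw [add_mul, mul_add, map_add, map_add, h1, h2]
  · intro r x y _ _ h; rw [smul_mul_assoc, mul_smul_comm, map_smul, map_smul, h]
  · intro r x y _ _ h; rw [smul_mul_assoc, mul_smul_comm, map_smul, map_smul, h]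

theorem isTracialState_trace (hω : IsCircleTwoCocycle ω) : IsTracialState (trace ω) where
  nonneg x := by
    rw [trace_star_mul_self, Complex.zero_le_real]
    positivity
  map_one := trace_one
  tracial := trace_mul_comm hω

/-- By traciality ‖x λ(g) δ_e‖² = τ(x* x) = 0 for every g, and λ(g) δ_e is a unimodular multiple of
δ_g, so x kills the whole basis. -/
theorem eq_zero_of_trace_star_mul_self (hω : IsCircleTwoCocycle ω)
    (x : twistedReducedCStarAlgebra ω) (hx : trace ω (star x * x) = 0) : x = 0 := by
  classical
  have h1 : ∀ g, (x : ellTwo G →L[ℂ] ellTwo G) (twistedLeftRegular ω g (delta G)) = 0 := by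
    intro g
    have h := trace_star_mul_self (x * gen ω g)
    rw [star_mul, mul_assoc, trace_mul_comm hω, ← mul_assoc, mul_assoc _ (gen ω g),
      (Unitary.mem_iff.1 (gen_mem_unitary hω g)).2, mul_one, hx] at h
    simpa [coe_gen] using h.symm
  have h2 : ∀ g, lp.single 2 g (1 : ℂ) =
      (ω g⁻¹ g : ℂ)⁻¹ • twistedLeftRegular ω g (delta G) := by
    intro g
    rw [eq_inv_smul_iff₀ (Circle.coe_ne_zero _)]
    ext k
    rw [twistedLeftRegular_apply, delta_apply, lp.coeFn_smul, Pi.smul_apply, lp.single_apply,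
      Pi.single_apply]
    by_cases hk : k = g
    · simp [hk]
    · have : g⁻¹ * k ≠ 1 := fun h => hk (inv_mul_eq_one.1 h).symm
      simp [hk, this]
  have h3 : ∀ g, (x : ellTwo G →L[ℂ] ellTwo G) (lp.single 2 g (1 : ℂ)) = 0 := fun g => by
    rw [h2, map_smul, h1, smul_zero]
  refine Subtype.ext (ContinuousLinearMap.ext fun ξ => ?_)
  have hs := (lp.hasSum_single (p := 2) (by simp) ξ).mapL (x : ellTwo G →L[ℂ] ellTwo G)
  refine hs.unique ?_
  have h4 : ∀ g, (x : ellTwo G →L[ℂ] ellTwo G) (lp.single 2 g (ξ g)) = 0 := fun g => by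
    have : lp.single (E := fun _ : G => ℂ) 2 g (ξ g) = ξ g • lp.single 2 g (1 : ℂ) := by
      rw [← lp.single_smul, smul_eq_mul, mul_one]
    rw [this, map_smul, h3, smul_zero]
  simp only [h4]
  exact hasSum_zero

end twistedReducedCStarAlgebra

end TwistedAlgebra

/-! ### Averaging over Powers sets -/

section Powers

variable {G : Type*} [Group G] {ω : G → G → Circle}

open Classical in
/-- A version of `IsPowersSet` in which the sets `T_j` have multiplicity at most `n`, in place of
being disjoint. -/
def IsPowersSetOfMultiplicity (n : ℕ) (H F : Set G) : Prop :=
  ∀ N : ℕ, ∃ (h : Fin N → G) (T : Fin N → Set G),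
    (∀ j, h j ∈ H) ∧
    (∀ x, (Finset.univ.filter fun j => x ∈ T j).card ≤ n) ∧
    ∀ j, IsLargeFor ((fun x => h j * x * (h j)⁻¹) '' F) (T j)

theorem IsPowersSet.isPowersSetOfMultiplicity_one {H F : Set G} (hHF : IsPowersSet H F) :
    IsPowersSetOfMultiplicity 1 H F := by
  classical
  intro N
  obtain ⟨h, T, hH, hT, hL⟩ := hHF N
  refine ⟨h, T, hH, fun x => Finset.card_le_one.2 fun i hi j hj => ?_, hL⟩
  by_contra hij
  exact Set.disjoint_left.1 (hT i j hij) (Finset.mem_filter.1 hi).2 (Finset.mem_filter.1 hj).2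

/-- The translates by `g₀⁻¹, g₀⁻², …` of the complement of `U` witness a Powers set. -/
theorem isPowersSetOfMultiplicity_of_wandering {n : ℕ} {F U : Set G} {g₀ : G}
    {D : Fin n → Set G} (hUD : Uᶜ ⊆ ⋃ k, D k) (hU : ∀ g ∈ F, (g • U) ∩ U = ∅)
    (hD : ∀ (j : ℕ) (k : Fin n), 1 ≤ j → ((g₀ ^ j)⁻¹ • D k) ∩ D k = ∅) :
    IsPowersSetOfMultiplicity n Set.univ F := by
  classical
  intro N
  refine ⟨fun j => (g₀ ^ (j : ℕ))⁻¹, fun j => (g₀ ^ (j : ℕ))⁻¹ • Uᶜ, fun _ => Set.mem_univ _,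
    fun x => ?_, ?_⟩
  · have hmem : ∀ j : Fin N, x ∈ (g₀ ^ (j : ℕ))⁻¹ • Uᶜ → ∃ k, g₀ ^ (j : ℕ) * x ∈ D k := by
      intro j hx
      rw [Set.mem_smul_set_iff_inv_smul_mem, inv_inv] at hx
      exact Set.mem_iUnion.1 (hUD hx)
    -- An orbit x, g₀x, g₀²x, … meets each D_k at most once, since two visits would contradict
    -- disjointness for the exponent j - i ≥ 1.
    have hlt : ∀ (i j : ℕ) (k : Fin n), g₀ ^ i * x ∈ D k → g₀ ^ j * x ∈ D k → ¬ i < j := by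
      intro i j k hi hj hij
      refine Set.eq_empty_iff_forall_notMem.1 (hD (j - i) k (by omega)) (g₀ ^ i * x) ⟨?_, hi⟩
      rw [Set.mem_smul_set_iff_inv_smul_mem, inv_inv, smul_eq_mul, ← mul_assoc, ← pow_add,
        Nat.sub_add_cancel hij.le]
      exact hj
    -- Each j with x ∈ T_j is matched to some k, and no k serves two values of j, so there are at
    -- most n such j.
    refine (Finset.card_le_card_of_forall_subsingleton (t := Finset.univ)
      (fun (j : Fin N) k => g₀ ^ (j : ℕ) * x ∈ D k) (fun j hj => ?_) fun k _ i hi j hj => ?_).trans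
      (Finset.card_fin n).le
    · obtain ⟨k, hk⟩ := hmem j (Finset.mem_filter.1 hj).2
      exact ⟨k, Finset.mem_univ _, hk⟩
    · have h1 := hlt i j k hi.2 hj.2
      have h2 := hlt j i k hj.2 hi.2
      exact Fin.ext (by omega)
  · rintro j _ ⟨f, hf, rfl⟩ _ ⟨z, hz, rfl⟩
    rw [Set.mem_compl_iff, Set.mem_smul_set_iff_inv_smul_mem, inv_inv, Set.notMem_compl_iff] at hz
    rw [Set.mem_smul_set_iff_inv_smul_mem]
    intro hU'
    refine Set.eq_empty_iff_forall_notMem.1 (hU f hf) _ ⟨⟨_, hz, rfl⟩, ?_⟩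
    simpa [mul_assoc] using hU'

/-- Averaging over a Powers set for `F` makes combinations of the `λ(f)`, `f ∈ F`, small. -/
theorem IsPowersSetOfMultiplicity.exists_norm_conjAverage_lt (hω : IsCircleTwoCocycle ω)
    {n : ℕ} {H F : Set G} (hHF : IsPowersSetOfMultiplicity n H F) {C ε : ℝ} (hC : 0 ≤ C)
    (hε : 0 < ε) :
    ∃ (N : ℕ) (h : Fin (N + 1) → G), (∀ j, h j ∈ H) ∧
      ∀ x ∈ Submodule.span ℂ (twistedReducedCStarAlgebra.gen ω '' F), ‖x‖ ≤ C →
        ‖conjAverage (fun j => twistedReducedCStarAlgebra.gen ω (h j)) x‖ < ε := by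
  -- Chosen so that 2C√((N+1)n) < ε(N+1), compared after squaring.
  obtain ⟨N, hN⟩ := exists_nat_gt ((2 * C) ^ 2 * n / ε ^ 2)
  obtain ⟨h, T, hH, hT, hL⟩ := hHF (N + 1)
  refine ⟨N, h, hH, fun x hx hxC => ?_⟩
  have hy : ∀ j, ellTwo.MapsComplTo (T j)
      ((twistedReducedCStarAlgebra.gen ω (h j) * x * star (twistedReducedCStarAlgebra.gen ω (h j)) :
        twistedReducedCStarAlgebra ω) : ellTwo G →L[ℂ] ellTwo G) := by
    intro j
    refine (hL j).mapsComplTo (ω := ω) (twistedReducedCStarAlgebra.coe_mem_span ?_)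
    clear hxC
    induction hx using Submodule.span_induction with
    | mem x hx =>
      obtain ⟨f, hf, rfl⟩ := hx
      obtain ⟨c, hc⟩ := twistedReducedCStarAlgebra.exists_conj_gen hω (h j) f
      rw [hc]
      exact Submodule.smul_mem _ _ (Submodule.subset_span ⟨_, ⟨f, hf, rfl⟩, rfl⟩)
    | zero => simp
    | add x y _ _ hx hy => rw [mul_add, add_mul]; exact add_mem hx hy
    | smul c x _ hx => rw [mul_smul_comm, smul_mul_assoc]; exact Submodule.smul_mem _ _ hx
  have hsum := ellTwo.norm_sum_le_of_mapsComplTo T hT _ hy hC fun j =>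
    (norm_conj_unitary (twistedReducedCStarAlgebra.gen_mem_unitary hω (h j)) x).trans_le hxC
  have hcoe : ‖∑ j, twistedReducedCStarAlgebra.gen ω (h j) * x *
      star (twistedReducedCStarAlgebra.gen ω (h j))‖ ≤ 2 * C * √((N + 1 : ℕ) * n) := by
    refine le_of_eq_of_le ?_ hsum
    rw [← AddSubmonoidClass.coe_finsetSum]
    rfl
  rw [conjAverage_apply, norm_smul, norm_inv, Complex.norm_natCast,
    inv_mul_lt_iff₀ (Nat.cast_pos.2 N.succ_pos)]
  refine hcoe.trans_lt (lt_of_pow_lt_pow_left₀ 2 (by positivity) ?_)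
  rw [mul_pow, Real.sq_sqrt (by positivity), mul_pow]
  rw [div_lt_iff₀ (by positivity)] at hN
  push_cast
  have : (0 : ℝ) < N + 1 := by positivity
  nlinarith [sq_nonneg ε, pow_pos hε 2]

/-- In a group of the class `𝒫`, iterated averages simultaneously shrink `λ(f)` for the elements
`f` of a finite set not containing `e`. -/
theorem InClassP.exists_norm_conjAverages_lt (hG : InClassP G) (hω : IsCircleTwoCocycle ω)
    {F : Set G} (hF : F.Finite) (h1 : (1 : G) ∉ F) {ε : ℝ} (hε : 0 < ε) :
    ∃ φ ∈ conjAverages (twistedReducedCStarAlgebra.gen ω) Set.univ,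
      ∀ f ∈ F, ‖φ (twistedReducedCStarAlgebra.gen ω f)‖ < ε := by
  have hu := twistedReducedCStarAlgebra.gen_mem_unitary hω
  rcases F.eq_empty_or_nonempty with rfl | hne
  · exact ⟨1, one_mem _, by simp⟩
  rcases hG with hG | hG
  · obtain ⟨n, f, K, -, rfl, hK, hP⟩ := hG F hF hne h1
    -- Treat the f_i in the order of the chain. Averaging so far over L ≤ K_m turns λ(f_m) into a
    -- combination of λ(a f_m a⁻¹) with a in a finite subset of K_m, exactly what the c-Powers
    -- condition handles. The new average over K_m is contractive, so the earlier estimates survive.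
    have key : ∀ m ≤ n, ∃ L : Subgroup G, (∀ i : Fin n, m ≤ i → L ≤ K i) ∧
        ∃ φ ∈ conjAverages (twistedReducedCStarAlgebra.gen ω) (L : Set G),
          ∀ i : Fin n, (i : ℕ) < m → ‖φ (twistedReducedCStarAlgebra.gen ω (f i))‖ < ε := by
      intro m
      induction m with
      | zero => exact fun _ => ⟨⊥, fun i _ => bot_le, 1, one_mem _, by simp⟩
      | succ m ih =>
        intro hm
        obtain ⟨L, hL, φ, hφ, hφε⟩ := ih (by omega)
        obtain ⟨M, hM, hM0, hML, hspan⟩ := exists_mem_span_conjugatesBy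
          (twistedReducedCStarAlgebra.exists_conj_gen hω) L hφ (f ⟨m, hm⟩)
        have hLK := hL ⟨m, hm⟩ le_rfl
        obtain ⟨N, h, hh, hlt⟩ := ((hP ⟨m, hm⟩ M hM hM0 (hML.trans hLK)
          ).isPowersSetOfMultiplicity_one).exists_norm_conjAverage_lt hω
          (norm_nonneg (φ (twistedReducedCStarAlgebra.gen ω (f ⟨m, hm⟩)))) hε
        have hA := conjAverage_mem_conjAverages (u := twistedReducedCStarAlgebra.gen ω) hh
        refine ⟨K ⟨m, hm⟩, fun i hi => hK (Fin.le_def.2 (by simp; omega)), _ * φ,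
          mul_mem hA (conjAverages_mono hLK hφ), fun i hi => ?_⟩
        rcases Nat.lt_succ_iff_lt_or_eq.1 hi with hi | hi
        · exact (norm_conjAverages_apply_le hu hA _).trans_lt (hφε i hi)
        · obtain rfl : i = ⟨m, hm⟩ := Fin.ext hi
          exact hlt _ hspan le_rfl
    obtain ⟨L, -, φ, hφ, h⟩ := key n le_rfl
    refine ⟨φ, conjAverages_mono (Set.subset_univ _) hφ, ?_⟩
    rintro _ ⟨i, rfl⟩
    exact h i i.2
  · obtain ⟨n, g₀, U, D, hUD, hU, hD⟩ := hG F hF hne h1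
    obtain ⟨N, h, hh, hlt⟩ := (isPowersSetOfMultiplicity_of_wandering hUD hU hD
      ).exists_norm_conjAverage_lt hω zero_le_one hε
    refine ⟨_, conjAverage_mem_conjAverages hh, fun f hf =>
      hlt _ (Submodule.subset_span ⟨f, hf, rfl⟩) ?_⟩
    exact (twistedLeftRegularIsometry ω f).norm_toContinuousLinearMap_le

end Powers

theorem corollary3p11 {G : Type*} [Group G] (hG : InClassP G)
    (ω : G → G → Circle) (hω : IsCircleTwoCocycle ω) :
    IsSimpleCStarAlgebra (twistedReducedCStarAlgebra ω) ∧
      ∃! τ : twistedReducedCStarAlgebra ω →ₗ[ℂ] ℂ, IsTracialState τ := by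
  let _ := twistedReducedCStarAlgebra.cstarAlgebra ω
  have hu := twistedReducedCStarAlgebra.gen_mem_unitary hω
  have hτ := twistedReducedCStarAlgebra.isTracialState_trace hω
  have : Nontrivial (twistedReducedCStarAlgebra ω) := by
    refine ⟨1, 0, fun h => ?_⟩
    have h1 := hτ.map_one
    rw [h, map_zero] at h1
    exact zero_ne_one h1
  have hD := fun a ε (hε : (0 : ℝ) < ε) =>
    dixmier_of_finset (K := Set.univ) hu hτ (twistedReducedCStarAlgebra.dense_span_gen hω)
    (fun s ε hε => by
      obtain ⟨φ, hφ, h⟩ := hG.exists_norm_conjAverages_lt hω (F := (s : Set G) \ {1})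
        (s.finite_toSet.subset Set.sdiff_subset) (by simp) hε
      refine ⟨φ, hφ, fun g hg => ?_⟩
      -- λ(e) is the scalar ω(e,e), which averaging fixes, so its error is exactly zero.
      by_cases hg1 : g = 1
      · subst hg1
        rw [twistedReducedCStarAlgebra.gen_one hω, map_smul, map_smul,
          conjAverages_apply_one hu hφ, hτ.map_one, smul_eq_mul, mul_one, sub_self, norm_zero]
        exact hε
      · rw [twistedReducedCStarAlgebra.trace_gen_of_ne hg1, zero_smul, sub_zero]
        exact h g ⟨hg, hg1⟩) a hε
  exact ⟨isSimpleCStarAlgebra_of_dixmier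
      (twistedReducedCStarAlgebra.eq_zero_of_trace_star_mul_self hω) hD,
    _, hτ, fun σ hσ => hσ.eq_of_dixmier hu hD⟩
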